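/- Let $I=\,]0,1]$. Let $\mathcal D_{L^p}$ be the space of smooth $\varphi:\mathbb R\to\mathbb C$ with $\varphi^{(j)}\in L^p$ for all $j\ge 0$, with the norms $|\varphi|_{k,p}=\sum_{j\le k}\|\varphi^{(j)}\|_{L^p}$, and let $\mathcal D'_{L^\infty}$ be the topological dual of $\mathcal D_{L^1}$. For $T\in\mathcal D'_{L^\infty}$ and $\varphi\in\mathcal D_{L^1}$ put $(T*\varphi)(x)=\langle T,\varphi(x-\cdot)\rangle$. Let $\mathcal C_{ap}$ be the space of (Bochner/Bohr) almost periodic functions on $\mathbb R$, let $\mathcal B'_{ap}$ be the space of almost periodic distributions, i.e. of those $T\in\mathcal D'_{L^\infty}$ with $T*\varphi\in\mathcal C_{ap}$ for all $\varphi\in\mathcal D=C_c^\infty(\mathbb R)$, and let $\mathcal B_{ap}=\{f\in\mathcal D_{L^\infty}: f^{(j)}\in\mathcal C_{ap}\ \forall j\}$. Let $$\mathcal M_{ap}=\{(u_\varepsilon)_\varepsilon\in\mathcal B_{ap}^I:\ \forall k\,\exists m,\ |u_\varepsilon|_{k,\infty}=O(\varepsilon^{-m})\},\qquad \mathcal N_{ap}=\{(u_\varepsilon)_\varepsilon\in\mathcal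 B_{ap}^I:\ \forall k\,\forall m,\ |u_\varepsilon|_{k,\infty}=O(\varepsilon^{m})\}$$ (as $\varepsilon\to0$), let $\mathcal G_{ap}=\mathcal M_{ap}/\mathcal N_{ap}$ be the algebra of almost periodic generalized functions, and let $\widetilde{\mathbb C}$ be the ring of generalized complex numbers, i.e. the quotient of the moderate families in $\mathbb C^I$ (those with $|c_\varepsilon|=O(\varepsilon^{-m})$ for some $m$) by the negligible ones ($|c_\varepsilon|=O(\varepsilon^{m})$ for all $m$); $\mathbb C$ is contained in $\widetilde{\mathbb C}$ as the classes of constant families. The generalized mean value $M_g:\mathcal G_{ap}\to\widetilde{\mathbb C}$ is $$M_g\big([(u_\varepsilon)_\varepsilon]\big)=\Big[\Big(\lim_{X\to+\infty}\frac1X\int_0^X u_\varepsilon(x)\,dx\Big)_\varepsilon\Big].$$ Let $\rho$ be a Schwartz function with $\int\rho=1$ and $\int x^k\rho(x)\,dx=0$ for all $k\ge1$, put $\rho_\varepsilon(x)=\frac1\varepsilon\rho(\frac x\varepsilon)$, and let $i_{ap}:\mathcal B'_{ap}\to\mathcal G_{ap}$, $i_{ap}(T)=[(T*\rho_\varepsilon)_\varepsilon]$.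 **Proposition.** Let $T\in\mathcal B'_{ap}$. There is exactly one number $M(T)\in\mathbb C$ (Schwartz's mean value of $T$) such that $$M(T)=\lim_{X\to+\infty}\frac1X\int_0^X(T*\varphi)(h)\,dh\quad\text{for every }\varphi\in\mathcal D\text{ with }\int_{\mathbb R}\varphi(x)\,dx=1.$$ Moreover $\lim_{X\to+\infty}\frac1X\int_0^X(T*\rho_\varepsilon)(h)\,dh=M(T)$ for every $\varepsilon\in I$, and hence $M_g(i_{ap}(T))=M(T)$; that is, $M_g(i_{ap}(T))$ is the class of the constant family $M(T)$, a complex number. -/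

import Mathlib

open Filter Topology MeasureTheory Set
open scoped BoundedContinuousFunction ContDiff ENNReal NNReal Distributions SchwartzMap

noncomputable section
namespace APGF

/-! ### Bohr almost periodic functions -/

/-- The translate `x ↦ F (x + h)` of a bounded continuous function. -/
def translate (h : ℝ) (F : ℝ →ᵇ ℂ) : ℝ →ᵇ ℂ :=
  F.compContinuous ⟨fun x => x + h, by fun_prop⟩

@[simp] lemma translate_apply (h : ℝ) (F : ℝ →ᵇ ℂ) (x : ℝ) : translate h F x = F (x + h) := rfl

/-- Bochner's condition: every sequence of translates has a subsequence that converges in the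
Banach space `C_b` of bounded continuous functions. -/
def Bochner (F : ℝ →ᵇ ℂ) : Prop :=
  ∀ h : ℕ → ℝ, ∃ s : ℕ → ℕ, StrictMono s ∧
    ∃ G : ℝ →ᵇ ℂ, Tendsto (fun k => translate (h (s k)) F) atTop (𝓝 G)

lemma Bochner.pair {F G : ℝ →ᵇ ℂ} (hF : Bochner F) (hG : Bochner G) (h : ℕ → ℝ) :
    ∃ s : ℕ → ℕ, StrictMono s ∧ ∃ F' G' : ℝ →ᵇ ℂ,
      Tendsto (fun k => translate (h (s k)) F) atTop (𝓝 F') ∧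
      Tendsto (fun k => translate (h (s k)) G) atTop (𝓝 G') := by
  obtain ⟨s, hs, F', hF'⟩ := hF h
  obtain ⟨t, ht, G', hG'⟩ := hG (h ∘ s)
  exact ⟨s ∘ t, hs.comp ht, F', G', hF'.comp ht.tendsto_atTop, hG'⟩

/-- The algebra `C_ap` of almost periodic functions, inside `C_b`. -/
def Cap : Subalgebra ℂ (ℝ →ᵇ ℂ) where
  carrier := {F | Bochner F}
  mul_mem' {F G} hF hG := fun h => by
    obtain ⟨s, hs, F', G', h1, h2⟩ := Bochner.pair hF hG h
    exact ⟨s, hs, F' * G', h1.mul h2⟩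
  add_mem' {F G} hF hG := fun h => by
    obtain ⟨s, hs, F', G', h1, h2⟩ := Bochner.pair hF hG h
    exact ⟨s, hs, F' + G', h1.add h2⟩
  algebraMap_mem' c := fun h =>
    ⟨id, strictMono_id, algebraMap ℂ (ℝ →ᵇ ℂ) c, tendsto_const_nhds⟩

/-- A function `ℝ → ℂ` is almost periodic if it is (bounded, continuous and) in `C_ap`. -/
def IsAP (f : ℝ → ℂ) : Prop := ∃ F ∈ Cap, ⇑F = f

lemma IsAP.add {f g : ℝ → ℂ} (hf : IsAP f) (hg : IsAP g) : IsAP (f + g) := by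
  obtain ⟨F, hF, rfl⟩ := hf
  obtain ⟨G, hG, rfl⟩ := hg
  exact ⟨F + G, Cap.add_mem hF hG, rfl⟩

lemma IsAP.mul {f g : ℝ → ℂ} (hf : IsAP f) (hg : IsAP g) : IsAP (f * g) := by
  obtain ⟨F, hF, rfl⟩ := hf
  obtain ⟨G, hG, rfl⟩ := hg
  exact ⟨F * G, Cap.mul_mem hF hG, rfl⟩

lemma isAP_const (c : ℂ) : IsAP (fun _ => c) :=
  ⟨algebraMap ℂ _ c, Cap.algebraMap_mem c, rfl⟩

lemma IsAP.smul {f : ℝ → ℂ} (c : ℂ) (hf : IsAP f) : IsAP (c • f) := (isAP_const c).mul hf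

lemma IsAP.sum {ι : Type*} {s : Finset ι} {f : ι → ℝ → ℂ} (h : ∀ i ∈ s, IsAP (f i)) :
    IsAP (∑ i ∈ s, f i) :=
  Finset.sum_induction f IsAP (fun _ _ => IsAP.add) (isAP_const 0) h

lemma IsAP.continuous {f : ℝ → ℂ} (hf : IsAP f) : Continuous f := by
  obtain ⟨F, -, rfl⟩ := hf
  exact F.continuous

lemma Bochner.totallyBounded {F : ℝ →ᵇ ℂ} (hF : Bochner F) :
    TotallyBounded (range fun h => translate h F) := by
  have : IsSeqCompact (closure (range fun h => translate h F)) := by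
    intro y hy
    have : ∀ n : ℕ, ∃ h : ℝ, dist (y n) (translate h F) < 1 / ((n : ℝ) + 1) := fun n => by
      obtain ⟨_, ⟨h, rfl⟩, hb⟩ := Metric.mem_closure_iff.1 (hy n) _ (Nat.one_div_pos_of_nat (n := n))
      exact ⟨h, hb⟩
    choose h hh using this
    obtain ⟨s, hs, G, hG⟩ := hF h
    refine ⟨G, mem_closure_of_tendsto hG (.of_forall fun k => ⟨_, rfl⟩), s, hs, ?_⟩
    refine (tendsto_iff_of_dist ?_).2 hG
    refine squeeze_zero (fun _ => dist_nonneg) (fun k => (hh (s k)).le) ?_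
    exact tendsto_one_div_add_atTop_nhds_zero_nat.comp hs.tendsto_atTop
  exact this.isCompact.totallyBounded.subset subset_closure

lemma bochner_of_totallyBounded {F : ℝ →ᵇ ℂ}
    (hF : TotallyBounded (range fun h => translate h F)) : Bochner F := fun h => by
  have hc : IsCompact (closure (range fun h => translate h F)) := 
    isCompact_iff_totallyBounded_isComplete.2 ⟨hF.closure, isClosed_closure.isComplete⟩
  obtain ⟨G, -, s, hs, hG⟩ := hc.tendsto_subseq (x := fun n => translate (h n) F)
    (fun n => subset_closure ⟨_, rfl⟩)
  exact ⟨s, hs, G, hG⟩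

lemma isClosed_Cap : IsClosed (Cap : Set (ℝ →ᵇ ℂ)) := by
  refine isClosed_of_closure_subset fun F hF => bochner_of_totallyBounded ?_
  rw [Metric.totallyBounded_iff]
  intro ε hε
  obtain ⟨G, hG, hFG⟩ := Metric.mem_closure_iff.1 hF (ε / 2) (by positivity)
  obtain ⟨t, ht, htG⟩ := Metric.totallyBounded_iff.1 (Bochner.totallyBounded hG) (ε / 2) (by positivity)
  refine ⟨t, ht, ?_⟩
  rintro _ ⟨h, rfl⟩
  obtain ⟨y, hy, hyG⟩ := mem_iUnion₂.1 (htG ⟨h, rfl⟩)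
  refine mem_iUnion₂.2 ⟨y, hy, ?_⟩
  have h1 : dist (translate h F) (translate h G) ≤ dist F G :=
    (BoundedContinuousFunction.dist_le dist_nonneg).2 fun x =>
      BoundedContinuousFunction.dist_coe_le_dist (x + h)
  have h2 : dist (translate h G) y < ε / 2 := hyG
  rw [Metric.mem_ball]
  linarith [dist_triangle (translate h F) (translate h G) y]

/-- A uniform limit of almost periodic functions is almost periodic. -/
lemma isAP_of_approx {f : ℝ → ℂ} (h : ∀ ε > 0, ∃ g, IsAP g ∧ ∀ x, ‖f x - g x‖ ≤ ε) : IsAP f := by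
  choose! g hg hfg using h
  have hlim : TendstoUniformly (fun n : ℕ => g (1 / ((n : ℝ) + 1))) f atTop := by
    rw [Metric.tendstoUniformly_iff]
    intro ε hε
    filter_upwards [tendsto_one_div_add_atTop_nhds_zero_nat.eventually (gt_mem_nhds hε)] with n hn x
    rw [dist_eq_norm]
    exact (hfg _ Nat.one_div_pos_of_nat x).trans_lt hn
  have hcont : Continuous f :=
    hlim.continuous (Frequently.of_forall fun n => (hg _ Nat.one_div_pos_of_nat).continuous)
  obtain ⟨G, hG, hGg⟩ := hg 1 one_pos
  have hbd : ∀ x, ‖f x‖ ≤ 1 + ‖G‖ := fun x => by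
    have h1 := hfg 1 one_pos x
    have h2 := G.norm_coe_le_norm x
    rw [hGg] at h2
    linarith [norm_sub_norm_le (f x) (g 1 x)]
  refine ⟨.ofNormedAddCommGroup f hcont _ hbd, ?_, rfl⟩
  refine isClosed_Cap.closure_subset (Metric.mem_closure_iff.2 fun ε hε => ?_)
  obtain ⟨G, hG, hGg⟩ := hg (ε / 2) (by positivity)
  refine ⟨G, hG, lt_of_le_of_lt ?_ (half_lt_self hε)⟩
  refine (BoundedContinuousFunction.dist_le (by positivity)).2 fun x => ?_
  rw [dist_eq_norm, hGg]
  exact hfg _ (by positivity) x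

/-! ### Mean values -/

/-- `X⁻¹ ∫₀ˣ f`. -/
def avg (f : ℝ → ℂ) (X : ℝ) : ℂ := X⁻¹ • ∫ x in (0 : ℝ)..X, f x

/-- The mean value of `f`, i.e. the limit of `X⁻¹ ∫₀ˣ f` as `X → +∞`. -/
def mean (f : ℝ → ℂ) : ℂ := limUnder atTop (avg f)

lemma norm_avg_le {f : ℝ → ℂ} {C : ℝ} (h : ∀ x, ‖f x‖ ≤ C) {X : ℝ} (hX : 0 < X) :
    ‖avg f X‖ ≤ C := by
  have h1 : ‖∫ x in (0 : ℝ)..X, f x‖ ≤ C * |X - 0| :=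
    intervalIntegral.norm_integral_le_of_norm_le_const fun x _ => h x
  rw [sub_zero, abs_of_pos hX] at h1
  rw [avg, norm_smul, norm_inv, Real.norm_of_nonneg hX.le, inv_mul_le_iff₀ hX, mul_comm X]
  exact h1

lemma avg_sub {f g : ℝ → ℂ} (hf : Continuous f) (hg : Continuous g) (X : ℝ) :
    avg (f - g) X = avg f X - avg g X := by
  simp only [avg, Pi.sub_apply, ← smul_sub]
  rw [intervalIntegral.integral_sub (hf.intervalIntegrable _ _) (hg.intervalIntegrable _ _)]

lemma tendsto_avg_translate_sub (F : ℝ →ᵇ ℂ) (a : ℝ) :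
    Tendsto (fun X => avg (translate a F) X - avg F X) atTop (𝓝 0) := by
  have key : ∀ X, avg (translate a F) X - avg F X =
      X⁻¹ • ((∫ x in X..(X + a), F x) - ∫ x in (0 : ℝ)..a, F x) := fun X => by
    have hi : ∀ p q : ℝ, IntervalIntegrable F volume p q := fun p q =>
      F.continuous.intervalIntegrable p q
    simp only [avg, translate_apply, ← smul_sub]
    rw [intervalIntegral.integral_comp_add_right (fun x => F x) a, zero_add,
      ← intervalIntegral.integral_add_adjacent_intervals (hi a X) (hi X (X + a)),
      ← intervalIntegral.integral_add_adjacent_intervals (hi 0 a) (hi a X)]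
    congr 1
    ring
  simp only [key]
  refine squeeze_zero_norm' (a := fun X : ℝ => X⁻¹ * (2 * (‖F‖ * |a|))) ?_ ?_
  · filter_upwards [eventually_gt_atTop (0 : ℝ)] with X hX
    rw [norm_smul, norm_inv, Real.norm_of_nonneg hX.le]
    gcongr
    have h1 : ‖∫ x in X..(X + a), F x‖ ≤ ‖F‖ * |X + a - X| :=
      intervalIntegral.norm_integral_le_of_norm_le_const fun x _ => F.norm_coe_le_norm x
    have h2 : ‖∫ x in (0 : ℝ)..a, F x‖ ≤ ‖F‖ * |a - 0| :=
      intervalIntegral.norm_integral_le_of_norm_le_const fun x _ => F.norm_coe_le_norm x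
    rw [add_sub_cancel_left] at h1
    rw [sub_zero] at h2
    linarith [norm_sub_le (∫ x in X..(X + a), F x) (∫ x in (0 : ℝ)..a, F x)]
  · simpa using tendsto_inv_atTop_zero.mul_const (2 * (‖F‖ * |a|))

lemma eventually_avg_translate {F : ℝ →ᵇ ℂ} (hF : Bochner F) {ε : ℝ} (hε : 0 < ε) :
    ∀ᶠ X in atTop, ∀ a, ‖avg (translate a F) X - avg F X‖ ≤ ε := by
  obtain ⟨t, htF, htfin, ht⟩ :=
    Metric.finite_approx_of_totallyBounded hF.totallyBounded (ε / 2) (by positivity)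
  have h1 : ∀ᶠ X in atTop, ∀ G ∈ t, ‖avg G X - avg F X‖ < ε / 2 := by
    refine (htfin.eventually_all).2 fun G hG => ?_
    obtain ⟨a, rfl⟩ := htF hG
    have := (tendsto_avg_translate_sub F a).norm
    rw [norm_zero] at this
    exact this.eventually (gt_mem_nhds (by positivity))
  filter_upwards [h1, eventually_gt_atTop (0 : ℝ)] with X hX hX0 a
  obtain ⟨G, hG, haG⟩ := mem_iUnion₂.1 (ht ⟨a, rfl⟩)
  have h2 : ‖avg (translate a F) X - avg G X‖ ≤ ε / 2 := by
    rw [← avg_sub (translate a F).continuous G.continuous]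
    refine norm_avg_le (fun x => ?_) hX0
    rw [Pi.sub_apply, ← dist_eq_norm]
    exact (BoundedContinuousFunction.dist_coe_le_dist x).trans (le_of_lt haG)
  linarith [hX G hG, norm_sub_le_norm_sub_add_norm_sub (avg (translate a F) X) (avg G X) (avg F X)]

lemma norm_avg_avg_sub_le (F : ℝ →ᵇ ℂ) {X Y ε : ℝ} (hY : 0 < Y)
    (h : ∀ a, ‖avg (translate a F) X - avg F X‖ ≤ ε) :
    ‖avg (fun a => avg (translate a F) X) Y - avg F X‖ ≤ ε := by
  have hc : Continuous fun a => avg (translate a F) X := by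
    have h2 : Continuous fun a => ∫ x in (0 : ℝ)..X, translate a F x := by
      refine intervalIntegral.continuous_parametric_intervalIntegral_of_continuous' ?_ _ _
      simp only [Function.uncurry_def, translate_apply]
      fun_prop
    exact h2.const_smul X⁻¹
  have h1 : avg (fun _ => avg F X) Y = avg F X := by
    rw [avg, intervalIntegral.integral_const, smul_smul, sub_zero, inv_mul_cancel₀ hY.ne', one_smul]
  have h2 := avg_sub hc (g := fun _ => avg F X) continuous_const Y
  rw [h1] at h2
  rw [← h2]
  exact norm_avg_le (fun a => h a) hY

lemma avg_avg_comm (F : ℝ →ᵇ ℂ) (X Y : ℝ) :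
    avg (fun a => avg (translate a F) X) Y = avg (fun a => avg (translate a F) Y) X := by
  simp only [avg, translate_apply, intervalIntegral.integral_smul]
  rw [smul_comm]
  congr 2
  rw [intervalIntegral_intervalIntegral_swap]
  · simp only [add_comm]
  · have : Continuous (Function.uncurry fun x y : ℝ => F (y + x)) := by
      simp only [Function.uncurry_def]
      fun_prop
    exact (this.continuousOn.integrableOn_compact (isCompact_uIcc.prod isCompact_uIcc)).mono_set
      (prod_mono uIoc_subset_uIcc uIoc_subset_uIcc)

/-- For almost periodic functions the mean value exists. -/
lemma IsAP.tendsto_avg {f : ℝ → ℂ} (hf : IsAP f) : Tendsto (avg f) atTop (𝓝 (mean f)) := by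
  refine tendsto_nhds_limUnder ?_
  obtain ⟨F, hF, rfl⟩ := hf
  refine cauchy_map_iff_exists_tendsto.1 ?_
  rw [Metric.cauchy_iff]
  refine ⟨inferInstance, fun ε hε => ?_⟩
  refine ⟨avg F '' {X | 0 < X ∧ ∀ a, ‖avg (translate a F) X - avg F X‖ ≤ ε / 3},
    image_mem_map ((eventually_gt_atTop (0 : ℝ)).and
      (eventually_avg_translate hF (by positivity))), ?_⟩
  rintro _ ⟨X, ⟨hX, hX'⟩, rfl⟩ _ ⟨Y, ⟨hY, hY'⟩, rfl⟩
  have h1 := norm_avg_avg_sub_le F hY hX'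
  have h2 := norm_avg_avg_sub_le F hX hY'
  rw [avg_avg_comm] at h1
  rw [dist_eq_norm]
  have h3 := norm_sub_le_norm_sub_add_norm_sub (avg F X)
    (avg (fun a => avg (translate a F) Y) X) (avg F Y)
  rw [norm_sub_rev (avg F X) (avg (fun a => avg (translate a F) Y) X)] at h3
  linarith

lemma IsAP.mean_sub {f g : ℝ → ℂ} (hf : IsAP f) (hg : IsAP g) : mean (f - g) = mean f - mean g := by
  have hfg : IsAP (f - g) := by
    have := hf.add (hg.smul (-1))
    rwa [neg_one_smul, ← sub_eq_add_neg] at this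
  refine tendsto_nhds_unique hfg.tendsto_avg ((hf.tendsto_avg.sub hg.tendsto_avg).congr fun X => ?_)
  exact (avg_sub hf.continuous hg.continuous X).symm

lemma IsAP.norm_mean_le {f : ℝ → ℂ} (hf : IsAP f) {C : ℝ} (h : ∀ x, ‖f x‖ ≤ C) : ‖mean f‖ ≤ C :=
  le_of_tendsto hf.tendsto_avg.norm <| by
    filter_upwards [eventually_gt_atTop (0 : ℝ)] with X hX using norm_avg_le h hX

/-! ### The spaces `D_{L^p}` and `B_ap` -/

lemma contDiffAt_of_smooth {f : ℝ → ℂ} (hf : ContDiff ℝ ∞ f) (n : ℕ) (x : ℝ) :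
    ContDiffAt ℝ n f x :=
  (hf.of_le (by exact_mod_cast le_top)).contDiffAt

lemma iteratedDeriv_add' {f g : ℝ → ℂ} (hf : ContDiff ℝ ∞ f) (hg : ContDiff ℝ ∞ g) (j : ℕ) :
    iteratedDeriv j (f + g) = iteratedDeriv j f + iteratedDeriv j g := by
  ext x
  exact iteratedDeriv_add (contDiffAt_of_smooth hf j x) (contDiffAt_of_smooth hg j x)

lemma iteratedDeriv_smul' (c : ℂ) {f : ℝ → ℂ} (hf : ContDiff ℝ ∞ f) (j : ℕ) :
    iteratedDeriv j (c • f) = c • iteratedDeriv j f := by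
  ext x
  exact iteratedDeriv_const_smul (contDiffAt_of_smooth hf j x) c

lemma iteratedDeriv_mul' {f g : ℝ → ℂ} (hf : ContDiff ℝ ∞ f) (hg : ContDiff ℝ ∞ g) (j : ℕ) :
    iteratedDeriv j (f * g) = ∑ i ∈ Finset.range (j + 1),
      ((j.choose i : ℂ) • (iteratedDeriv i f * iteratedDeriv (j - i) g)) := by
  ext x
  rw [iteratedDeriv_mul (contDiffAt_of_smooth hf j x) (contDiffAt_of_smooth hg j x)]
  simp [mul_assoc]

lemma iteratedDeriv_const' (c : ℂ) (j : ℕ) :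
    iteratedDeriv j (fun _ : ℝ => c) = fun _ => if j = 0 then c else 0 := by
  ext x
  rw [iteratedDeriv_const]

/-- The space `D_{L^p}` of smooth functions all of whose derivatives are in `L^p`. -/
def DL (p : ℝ≥0∞) : Submodule ℂ (ℝ → ℂ) where
  carrier := {φ | ContDiff ℝ ∞ φ ∧ ∀ j : ℕ, MemLp (iteratedDeriv j φ) p volume}
  add_mem' {f g} hf hg := ⟨hf.1.add hg.1, fun j => by
    rw [iteratedDeriv_add' hf.1 hg.1]
    exact (hf.2 j).add (hg.2 j)⟩
  zero_mem' := ⟨contDiff_const, fun j => by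
    have : iteratedDeriv j (0 : ℝ → ℂ) = 0 := by
      simpa using iteratedDeriv_smul' 0 (f := 0) contDiff_const j
    rw [this]
    exact MemLp.zero⟩
  smul_mem' c f hf := ⟨contDiff_const.smul hf.1, fun j => by
    rw [iteratedDeriv_smul' c hf.1]
    exact (hf.2 j).const_smul c⟩

/-- The norm `|φ|_{k,p} = ∑_{j ≤ k} ‖φ^(j)‖_{L^p}` on `D_{L^p}`. -/
def dlNorm (p : ℝ≥0∞) (k : ℕ) (φ : ℝ → ℂ) : ℝ :=
  ∑ j ∈ Finset.range (k + 1), (eLpNorm (iteratedDeriv j φ) p volume).toReal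

lemma dlNorm_nonneg (p : ℝ≥0∞) (k : ℕ) (φ : ℝ → ℂ) : 0 ≤ dlNorm p k φ :=
  Finset.sum_nonneg fun _ _ => ENNReal.toReal_nonneg

lemma dlNorm_add_le {p : ℝ≥0∞} (hp : 1 ≤ p) (k : ℕ) {f g : ℝ → ℂ} (hf : f ∈ DL p)
    (hg : g ∈ DL p) : dlNorm p k (f + g) ≤ dlNorm p k f + dlNorm p k g := by
  unfold dlNorm
  rw [← Finset.sum_add_distrib]
  refine Finset.sum_le_sum fun j _ => ?_
  rw [iteratedDeriv_add' hf.1 hg.1,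
    ← ENNReal.toReal_add (hf.2 j).eLpNorm_ne_top (hg.2 j).eLpNorm_ne_top]
  exact ENNReal.toReal_mono (ENNReal.add_ne_top.2 ⟨(hf.2 j).eLpNorm_ne_top, (hg.2 j).eLpNorm_ne_top⟩)
    (eLpNorm_add_le (hf.2 j).1 (hg.2 j).1 hp)

lemma dlNorm_smul (p : ℝ≥0∞) (k : ℕ) (c : ℂ) {f : ℝ → ℂ} (hf : f ∈ DL p) :
    dlNorm p k (c • f) = ‖c‖ * dlNorm p k f := by
  unfold dlNorm
  rw [Finset.mul_sum]
  refine Finset.sum_congr rfl fun j _ => ?_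
  rw [iteratedDeriv_smul' c hf.1, eLpNorm_const_smul, ENNReal.toReal_mul, toReal_enorm]

/-- For continuous functions the `L^∞` norm is the supremum norm. -/
lemma norm_le_of_continuous {f : ℝ → ℂ} (hf : Continuous f) (hf' : MemLp f ⊤ volume) (x : ℝ) :
    ‖f x‖ ≤ (eLpNorm f ⊤ volume).toReal := by
  have h1 : ∀ᵐ x ∂(volume : Measure ℝ), ‖f x‖ ≤ (eLpNorm f ⊤ volume).toReal := by
    filter_upwards [ae_le_eLpNormEssSup (f := f) (μ := volume)] with x hx
    rw [← toReal_enorm, eLpNorm_exponent_top]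
    exact ENNReal.toReal_mono (by simpa using hf'.eLpNorm_ne_top) hx
  have h2 : IsClosed {x | ‖f x‖ ≤ (eLpNorm f ⊤ volume).toReal} :=
    isClosed_le hf.norm continuous_const
  have h3 := (Measure.dense_of_ae h1).closure_eq
  rw [h2.closure_eq] at h3
  exact h3.ge (mem_univ x)

lemma toReal_eLpNorm_top_le {f : ℝ → ℂ} {C : ℝ} (hC : 0 ≤ C) (h : ∀ x, ‖f x‖ ≤ C) :
    (eLpNorm f ⊤ volume).toReal ≤ C := by
  rw [eLpNorm_exponent_top]
  refine ENNReal.toReal_le_of_le_ofReal hC (eLpNormEssSup_le_of_ae_bound (.of_forall h))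

lemma continuous_iteratedDeriv' {f : ℝ → ℂ} (hf : ContDiff ℝ ∞ f) (j : ℕ) :
    Continuous (iteratedDeriv j f) :=
  hf.continuous_iteratedDeriv j (by exact_mod_cast le_top)

lemma norm_iteratedDeriv_le_dlNorm {f : ℝ → ℂ} (hf : f ∈ DL ⊤) {j k : ℕ} (hjk : j ≤ k) (x : ℝ) :
    ‖iteratedDeriv j f x‖ ≤ dlNorm ⊤ k f :=
  (norm_le_of_continuous (continuous_iteratedDeriv' hf.1 j) (hf.2 j) x).trans <|
    Finset.single_le_sum (f := fun j => (eLpNorm (iteratedDeriv j f) ⊤ volume).toReal)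
      (fun _ _ => ENNReal.toReal_nonneg) (Finset.mem_range_succ_iff.2 hjk)

lemma dlNorm_top_le {f : ℝ → ℂ} {k : ℕ} {C : ℝ} (hC : 0 ≤ C)
    (h : ∀ j ≤ k, ∀ x, ‖iteratedDeriv j f x‖ ≤ C) : dlNorm ⊤ k f ≤ (k + 1) * C := by
  have := Finset.sum_le_card_nsmul (Finset.range (k + 1))
    (fun j => (eLpNorm (iteratedDeriv j f) ⊤ volume).toReal) C
    (fun j hj => toReal_eLpNorm_top_le hC (h j (Finset.mem_range_succ_iff.1 hj)))
  simpa [dlNorm] using this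

lemma IsAP.memLp_top {f : ℝ → ℂ} (hf : IsAP f) : MemLp f ⊤ volume := by
  obtain ⟨F, -, rfl⟩ := hf
  exact memLp_top_of_bound F.continuous.aestronglyMeasurable ‖F‖ (.of_forall F.norm_coe_le_norm)

lemma mem_DL_top {f : ℝ → ℂ} (hf : ContDiff ℝ ∞ f) (h : ∀ j : ℕ, IsAP (iteratedDeriv j f)) :
    f ∈ DL ⊤ := ⟨hf, fun j => (h j).memLp_top⟩

/-- The algebra `B_ap` of functions in `D_{L^∞}` all of whose derivatives are almost periodic. -/
def Bap : Subalgebra ℂ (ℝ → ℂ) where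
  carrier := {f | f ∈ DL ⊤ ∧ ∀ j : ℕ, IsAP (iteratedDeriv j f)}
  mul_mem' {f g} hf hg := by
    have h : ∀ j : ℕ, IsAP (iteratedDeriv j (f * g)) := fun j => by
      rw [iteratedDeriv_mul' hf.1.1 hg.1.1]
      exact IsAP.sum fun i _ => ((hf.2 i).mul (hg.2 (j - i))).smul _
    exact ⟨mem_DL_top (hf.1.1.mul hg.1.1) h, h⟩
  add_mem' {f g} hf hg := ⟨Submodule.add_mem _ hf.1 hg.1, fun j => by
    rw [iteratedDeriv_add' hf.1.1 hg.1.1]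
    exact (hf.2 j).add (hg.2 j)⟩
  algebraMap_mem' c := by
    have h : ∀ j : ℕ, IsAP (iteratedDeriv j (algebraMap ℂ (ℝ → ℂ) c)) := fun j => by
      have := iteratedDeriv_const' c j
      exact this ▸ isAP_const _
    exact ⟨mem_DL_top contDiff_const h, h⟩

lemma isAP_of_mem_Bap {f : ℝ → ℂ} (hf : f ∈ Bap) : IsAP f := by simpa using hf.2 0

lemma dlNorm_mul_le {f g : ℝ → ℂ} (hf : f ∈ DL ⊤) (hg : g ∈ DL ⊤) (k : ℕ) :
    dlNorm ⊤ k (f * g) ≤ (k + 1) * (2 ^ k * (dlNorm ⊤ k f * dlNorm ⊤ k g)) := by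
  have h0 : 0 ≤ dlNorm ⊤ k f * dlNorm ⊤ k g := mul_nonneg (dlNorm_nonneg _ _ _) (dlNorm_nonneg _ _ _)
  refine dlNorm_top_le (by positivity) fun j hj x => ?_
  rw [iteratedDeriv_mul' hf.1 hg.1, Finset.sum_apply]
  refine (norm_sum_le _ _).trans ?_
  calc ∑ i ∈ Finset.range (j + 1), ‖((j.choose i : ℂ) •
          (iteratedDeriv i f * iteratedDeriv (j - i) g)) x‖
      ≤ ∑ i ∈ Finset.range (j + 1), (j.choose i : ℝ) * (dlNorm ⊤ k f * dlNorm ⊤ k g) := by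
        refine Finset.sum_le_sum fun i hi => ?_
        have hi := Finset.mem_range_succ_iff.1 hi
        rw [Pi.smul_apply, norm_smul, Complex.norm_natCast, Pi.mul_apply, norm_mul]
        gcongr
        · exact dlNorm_nonneg _ _ _
        · exact norm_iteratedDeriv_le_dlNorm hf (hi.trans hj) x
        · exact norm_iteratedDeriv_le_dlNorm hg ((Nat.sub_le _ _).trans hj) x
    _ = 2 ^ j * (dlNorm ⊤ k f * dlNorm ⊤ k g) := by
        rw [← Finset.sum_mul]
        congr 1
        exact_mod_cast Nat.sum_range_choose j
    _ ≤ 2 ^ k * (dlNorm ⊤ k f * dlNorm ⊤ k g) := by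
        gcongr
        norm_num

/-! ### Moderate and negligible families -/

/-- The parameter set `]0, 1]`. -/
abbrev I : Type := Ioc (0 : ℝ) 1

/-- The filter `ε → 0` on `]0, 1]`. -/
def toZero : Filter I := comap (fun ε : I => (ε : ℝ)) (𝓝 0)

/-- `n ε = O(ε^{-m})` for some `m`. -/
def Moderate (n : I → ℝ) : Prop := ∃ m : ℕ, n =O[toZero] fun ε => ((ε : ℝ) ^ m)⁻¹

/-- `n ε = O(ε^m)` for all `m`. -/
def Negligible (n : I → ℝ) : Prop := ∀ m : ℕ, n =O[toZero] fun ε => (ε : ℝ) ^ m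

lemma inv_pow_le (ε : I) {m m' : ℕ} (h : m ≤ m') : ((ε : ℝ) ^ m)⁻¹ ≤ ((ε : ℝ) ^ m')⁻¹ := by
  have h0 := ε.2.1
  exact inv_anti₀ (by positivity) (pow_le_pow_of_le_one h0.le ε.2.2 h)

lemma Moderate.of_le {n n' : I → ℝ} (hn : Moderate n) {C : ℝ} (h : ∀ ε, |n' ε| ≤ C * |n ε|) :
    Moderate n' := by
  obtain ⟨m, hm⟩ := hn
  exact ⟨m, (Asymptotics.IsBigO.of_bound C (.of_forall h)).trans hm⟩

lemma Moderate.add {n n' : I → ℝ} (hn : Moderate n) (hn' : Moderate n') :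
    Moderate fun ε => n ε + n' ε := by
  obtain ⟨m, hm⟩ := hn
  obtain ⟨m', hm'⟩ := hn'
  refine ⟨max m m', (hm.trans ?_).add (hm'.trans ?_)⟩
  · refine Asymptotics.IsBigO.of_bound 1 (.of_forall fun ε => ?_)
    have h0 := ε.2.1
    rw [one_mul, Real.norm_of_nonneg (by positivity), Real.norm_of_nonneg (by positivity)]
    exact inv_pow_le ε (le_max_left _ _)
  · refine Asymptotics.IsBigO.of_bound 1 (.of_forall fun ε => ?_)
    have h0 := ε.2.1
    rw [one_mul, Real.norm_of_nonneg (by positivity), Real.norm_of_nonneg (by positivity)]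
    exact inv_pow_le ε (le_max_right _ _)

lemma Moderate.mul {n n' : I → ℝ} (hn : Moderate n) (hn' : Moderate n') :
    Moderate fun ε => n ε * n' ε := by
  obtain ⟨m, hm⟩ := hn
  obtain ⟨m', hm'⟩ := hn'
  refine ⟨m + m', (hm.mul hm').congr_right fun ε => ?_⟩
  rw [pow_add, mul_inv]

lemma moderate_of_bounded {n : I → ℝ} {C : ℝ} (h : ∀ ε, |n ε| ≤ C) : Moderate n :=
  ⟨0, Asymptotics.IsBigO.of_bound C (.of_forall fun ε => by simpa using h ε)⟩

lemma Negligible.of_le {n n' : I → ℝ} (hn : Negligible n) {C : ℝ} (h : ∀ ε, |n' ε| ≤ C * |n ε|) :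
    Negligible n' := fun m => (Asymptotics.IsBigO.of_bound C (.of_forall h)).trans (hn m)

lemma Negligible.add {n n' : I → ℝ} (hn : Negligible n) (hn' : Negligible n') :
    Negligible fun ε => n ε + n' ε := fun m => (hn m).add (hn' m)

lemma Moderate.mul_negligible {n n' : I → ℝ} (hn : Moderate n) (hn' : Negligible n') :
    Negligible fun ε => n ε * n' ε := fun m => by
  obtain ⟨l, hl⟩ := hn
  refine (hl.mul (hn' (l + m))).congr_right fun ε => ?_
  have h0 := ε.2.1.ne'
  rw [pow_add, inv_mul_cancel_left₀ (pow_ne_zero _ h0)]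

/-! ### The algebra of almost periodic generalized functions -/

/-- The algebra `M_ap` of moderate families in `B_ap`. -/
def Map : Subalgebra ℂ (I → ℝ → ℂ) where
  carrier := {u | (∀ ε, u ε ∈ Bap) ∧ ∀ k : ℕ, Moderate fun ε => dlNorm ⊤ k (u ε)}
  mul_mem' {u v} hu hv := ⟨fun ε => Bap.mul_mem (hu.1 ε) (hv.1 ε), fun k =>
    ((hu.2 k).mul (hv.2 k)).of_le (C := (k + 1) * 2 ^ k) fun ε => by
      rw [abs_of_nonneg (dlNorm_nonneg _ _ _), abs_of_nonneg
        (mul_nonneg (dlNorm_nonneg _ _ _) (dlNorm_nonneg _ _ _)), mul_assoc]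
      exact dlNorm_mul_le (hu.1 ε).1 (hv.1 ε).1 k⟩
  add_mem' {u v} hu hv := ⟨fun ε => Bap.add_mem (hu.1 ε) (hv.1 ε), fun k =>
    ((hu.2 k).add (hv.2 k)).of_le (C := 1) fun ε => by
      rw [abs_of_nonneg (dlNorm_nonneg _ _ _), abs_of_nonneg
        (add_nonneg (dlNorm_nonneg _ _ _) (dlNorm_nonneg _ _ _)), one_mul]
      exact dlNorm_add_le le_top k (hu.1 ε).1 (hv.1 ε).1⟩
  algebraMap_mem' c := ⟨fun _ => Bap.algebraMap_mem c, fun k =>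
    moderate_of_bounded (C := dlNorm ⊤ k (algebraMap ℂ (ℝ → ℂ) c)) fun ε =>
      (abs_of_nonneg (dlNorm_nonneg _ _ _)).le⟩

/-- The ideal `N_ap` of negligible families in `B_ap` (a family in `B_ap` whose norms are
negligible is moderate, so that it is no restriction to define it inside `M_ap`). -/
def Nap : Ideal Map where
  carrier := {u | ∀ k : ℕ, Negligible fun ε => dlNorm ⊤ k (u.1 ε)}
  add_mem' {u v} hu hv := fun k => ((hu k).add (hv k)).of_le (C := 1) fun ε => by
    rw [abs_of_nonneg (dlNorm_nonneg _ _ _), abs_of_nonneg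
      (add_nonneg (dlNorm_nonneg _ _ _) (dlNorm_nonneg _ _ _)), one_mul]
    exact dlNorm_add_le le_top k (u.2.1 ε).1 (v.2.1 ε).1
  zero_mem' := fun k => by
    have h : (fun ε : I => dlNorm ⊤ k ((0 : Map).1 ε)) = fun _ => 0 := by
      ext ε
      have := dlNorm_smul ⊤ k 0 (f := 0) (Submodule.zero_mem (DL ⊤))
      simpa using this
    intro m
    rw [h]
    exact Asymptotics.isBigO_zero _ _
  smul_mem' c u hu := fun k =>
    ((c.2.2 k).mul_negligible (hu k)).of_le (C := (k + 1) * 2 ^ k) fun ε => by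
      rw [abs_of_nonneg (dlNorm_nonneg _ _ _), abs_of_nonneg
        (mul_nonneg (dlNorm_nonneg _ _ _) (dlNorm_nonneg _ _ _)), mul_assoc]
      exact dlNorm_mul_le (c.2.1 ε).1 (u.2.1 ε).1 k

/-- The algebra `G_ap = M_ap / N_ap` of almost periodic generalized functions. -/
abbrev Gap : Type := Map ⧸ Nap

/-- The algebra of moderate families of complex numbers. -/
def ModC : Subalgebra ℂ (I → ℂ) where
  carrier := {c | Moderate fun ε => ‖c ε‖}
  mul_mem' {c d} hc hd := (Moderate.mul hc hd).of_le (C := 1) fun ε => by simp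
  add_mem' {c d} hc hd := (Moderate.add hc hd).of_le (C := 1) fun ε => by
    rw [abs_norm, one_mul, abs_of_nonneg (by positivity)]
    exact norm_add_le _ _
  algebraMap_mem' c := moderate_of_bounded (C := ‖c‖) fun ε => by simp

/-- The ideal of negligible families of complex numbers. -/
def NegC : Ideal ModC where
  carrier := {c | Negligible fun ε => ‖c.1 ε‖}
  add_mem' {c d} hc hd := (Negligible.add hc hd).of_le (C := 1) fun ε => by
    rw [abs_norm, one_mul, abs_of_nonneg (by positivity)]
    exact norm_add_le _ _
  zero_mem' := fun m => by simpa using Asymptotics.isBigO_zero _ _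
  smul_mem' c u hu := (Moderate.mul_negligible c.2 hu).of_le (C := 1) fun ε => by simp

/-- The ring of generalized complex numbers; `algebraMap ℂ GenC` sends `z` to the class of the
constant family `z`. -/
abbrev GenC : Type := ModC ⧸ NegC

/-! ### The generalized mean value -/

lemma norm_mean_le_dlNorm {f : ℝ → ℂ} (hf : f ∈ Bap) : ‖mean f‖ ≤ dlNorm ⊤ 0 f :=
  (isAP_of_mem_Bap hf).norm_mean_le fun x => by
    simpa using norm_iteratedDeriv_le_dlNorm hf.1 (le_refl 0) x

lemma mean_moderate (u : Map) : (fun ε => mean (u.1 ε)) ∈ ModC :=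
  (u.2.2 0).of_le (C := 1) fun ε => by
    rw [abs_norm, one_mul]
    exact (norm_mean_le_dlNorm (u.2.1 ε)).trans (le_abs_self _)

lemma mean_negligible {u v : Map} (h : u - v ∈ Nap) :
    (⟨_, mean_moderate u⟩ - ⟨_, mean_moderate v⟩ : ModC) ∈ NegC :=
  Negligible.of_le (h 0) (C := 1) fun ε => by
    rw [abs_norm, one_mul]
    change ‖mean (u.1 ε) - mean (v.1 ε)‖ ≤ |dlNorm ⊤ 0 ((u - v).1 ε)|
    rw [← (isAP_of_mem_Bap (u.2.1 ε)).mean_sub (isAP_of_mem_Bap (v.2.1 ε))]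
    exact (norm_mean_le_dlNorm ((u - v).2.1 ε)).trans (le_abs_self _)

/-- The generalized mean value `M_g : G_ap → GenC`: the class of the family of the mean values of
the members of a representative. -/
def Mg (u : Gap) : GenC :=
  Quotient.liftOn u (fun v : Map => Ideal.Quotient.mk NegC ⟨_, mean_moderate v⟩) fun _ _ h =>
    (Ideal.Quotient.eq).2 (mean_negligible ((Submodule.quotientRel_def Nap).1 h))

@[simp] lemma Mg_mk (u : Map) :
    Mg (Ideal.Quotient.mk Nap u) = Ideal.Quotient.mk NegC ⟨_, mean_moderate u⟩ := rfl

/-! ### Bounded distributions -/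

/-- The space `D_{L^1}` as a type, which carries the topology of the norms `|·|_{k,1}`. -/
def DL1 : Type := DL 1

instance : AddCommGroup DL1 := inferInstanceAs (AddCommGroup (DL 1))
instance : Module ℂ DL1 := inferInstanceAs (Module ℂ (DL 1))

/-- The underlying function of an element of `D_{L^1}`. -/
def DL1.fn (φ : DL1) : ℝ → ℂ := φ.1

lemma DL1.mem (φ : DL1) : φ.fn ∈ DL 1 := φ.2
lemma DL1.smooth (φ : DL1) : ContDiff ℝ ∞ φ.fn := φ.2.1
lemma DL1.ext {φ ψ : DL1} (h : ∀ x, φ.fn x = ψ.fn x) : φ = ψ := Subtype.ext (funext h)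
@[simp] lemma DL1.fn_add (φ ψ : DL1) : (φ + ψ).fn = φ.fn + ψ.fn := rfl
@[simp] lemma DL1.fn_sub (φ ψ : DL1) : (φ - ψ).fn = φ.fn - ψ.fn := rfl
@[simp] lemma DL1.fn_smul (c : ℂ) (φ : DL1) : (c • φ).fn = c • φ.fn := rfl

/-- The family of norms `|·|_{k,1}` on `D_{L^1}`. -/
def dl1Norms : SeminormFamily ℂ DL1 ℕ := fun k =>
  Seminorm.of (fun φ => dlNorm 1 k φ.fn) (fun φ ψ => dlNorm_add_le le_rfl k φ.mem ψ.mem)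
    (fun c φ => dlNorm_smul 1 k c φ.mem)

instance : TopologicalSpace DL1 := dl1Norms.moduleFilterBasis.topology

lemma withSeminorms_DL1 : WithSeminorms dl1Norms := ⟨rfl⟩

/-- The space `D'_{L^∞}` of bounded distributions, the topological dual of `D_{L^1}`. -/
abbrev BDist : Type := DL1 →L[ℂ] ℂ

lemma dlNorm_mono (p : ℝ≥0∞) (φ : ℝ → ℂ) : Monotone fun k => dlNorm p k φ := fun _ _ h =>
  Finset.sum_le_sum_of_subset_of_nonneg (Finset.range_mono (by omega))
    fun _ _ _ => ENNReal.toReal_nonneg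

lemma BDist.bound (T : BDist) : ∃ (K : ℕ) (C : ℝ), 0 ≤ C ∧ ∀ φ, ‖T φ‖ ≤ C * dlNorm 1 K φ.fn := by
  obtain ⟨s, C, -, h⟩ := Seminorm.bound_of_continuous withSeminorms_DL1
    ((normSeminorm ℂ ℂ).comp T.toLinearMap) (continuous_norm.comp T.continuous)
  refine ⟨s.sup id, C, C.2, fun φ => (h φ).trans ?_⟩
  refine mul_le_mul_of_nonneg_left ?_ C.2
  refine Seminorm.finset_sup_apply_le (dlNorm_nonneg _ _ _) fun k hk => ?_
  exact dlNorm_mono 1 φ.fn (Finset.le_sup (f := id) hk)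

/-! ### Operations on `D_{L^1}` -/

/-- The function `y ↦ φ (x - y)`. -/
def reflTranslate (x : ℝ) (φ : DL1) : DL1 := ⟨fun y => φ.fn (x - y), by
  refine ⟨φ.smooth.comp (contDiff_const.sub contDiff_id), fun j => ?_⟩
  rw [iteratedDeriv_comp_const_sub]
  exact ((φ.mem.2 j).comp_measurePreserving (volume.measurePreserving_sub_left x)).const_smul
    ((-1 : ℝ) ^ j)⟩

@[simp] lemma reflTranslate_fn (x : ℝ) (φ : DL1) (y : ℝ) :
    (reflTranslate x φ).fn y = φ.fn (x - y) := rfl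

lemma dlNorm_reflTranslate (k : ℕ) (x : ℝ) (φ : DL1) :
    dlNorm 1 k (reflTranslate x φ).fn = dlNorm 1 k φ.fn := by
  refine Finset.sum_congr rfl fun j _ => ?_
  change (eLpNorm (iteratedDeriv j fun y => φ.fn (x - y)) 1 volume).toReal = _
  rw [iteratedDeriv_comp_const_sub]
  congr 1
  have := eLpNorm_comp_measurePreserving (φ.mem.2 j).1 (volume.measurePreserving_sub_left x)
    (p := 1)
  rw [← this]
  refine eLpNorm_congr_norm_ae (.of_forall fun y => ?_)
  simp

/-- The derivative of a function in `D_{L^1}`. -/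
def DL1.deriv (φ : DL1) : DL1 := ⟨_root_.deriv φ.fn, by
  refine ⟨(contDiff_infty_iff_deriv.1 φ.smooth).2, fun j => ?_⟩
  rw [← iteratedDeriv_succ']
  exact φ.mem.2 (j + 1)⟩

lemma DL1.deriv_fn (φ : DL1) : φ.deriv.fn = _root_.deriv φ.fn := rfl

lemma DL1.iteratedDeriv_deriv (φ : DL1) (j : ℕ) :
    iteratedDeriv j φ.deriv.fn = iteratedDeriv (j + 1) φ.fn := by
  rw [iteratedDeriv_succ', DL1.deriv_fn]

lemma DL1.iteratedDeriv_iterate (φ : DL1) (i j : ℕ) :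
    iteratedDeriv j (DL1.deriv^[i] φ).fn = iteratedDeriv (j + i) φ.fn := by
  induction i generalizing j with
  | zero => rfl
  | succ i ih => rw [Function.iterate_succ_apply', DL1.iteratedDeriv_deriv, ih]; congr 1; ring

lemma DL1.dlNorm_iterate_le (φ : DL1) (K i : ℕ) :
    dlNorm 1 K (DL1.deriv^[i] φ).fn ≤ dlNorm 1 (K + i) φ.fn := by
  unfold dlNorm
  simp only [DL1.iteratedDeriv_iterate]
  rw [← Finset.sum_image (f := fun j => (eLpNorm (iteratedDeriv j φ.fn) 1 volume).toReal)
    (g := fun j => j + i) (fun a _ b _ h => by simpa using h)]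
  refine Finset.sum_le_sum_of_subset_of_nonneg (fun j hj => ?_) fun _ _ _ => ENNReal.toReal_nonneg
  simp only [Finset.mem_image, Finset.mem_range] at hj ⊢
  omega

/-- The rescaled function `φ_ε (x) = (1 / ε) φ (x / ε)`. -/
def dilate (ε : I) (φ : DL1) : DL1 := ⟨fun x => ((1 / (ε : ℝ) : ℝ) : ℂ) * φ.fn (x / ε), by
  have h1 : ContDiff ℝ ∞ fun x : ℝ => φ.fn ((ε : ℝ)⁻¹ * x) :=
    φ.smooth.comp (contDiff_const.mul contDiff_id)
  have h2 : (fun x : ℝ => φ.fn ((ε : ℝ)⁻¹ * x)) ∈ DL 1 := by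
    refine ⟨h1, fun j => ?_⟩
    rw [iteratedDeriv_comp_const_smul (φ.smooth.of_le (by exact_mod_cast le_top))]
    refine MemLp.const_smul ?_ (((ε : ℝ)⁻¹) ^ j)
    exact memLp_one_iff_integrable.2
      ((memLp_one_iff_integrable.1 (φ.mem.2 j)).comp_mul_left' (inv_ne_zero ε.2.1.ne'))
  have h3 := (DL 1).smul_mem ((1 / (ε : ℝ) : ℝ) : ℂ) h2
  convert h3 using 1
  ext x
  simp [div_eq_inv_mul]⟩

lemma dlNorm_dilate_le (k : ℕ) (ε : I) (φ : DL1) :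
    dlNorm 1 k (dilate ε φ).fn ≤ ((ε : ℝ) ^ k)⁻¹ * dlNorm 1 k φ.fn := by
  unfold dlNorm
  rw [Finset.mul_sum]
  refine Finset.sum_le_sum fun j hj => ?_
  have hε := ε.2.1
  have h1 : ContDiff ℝ ∞ fun x : ℝ => φ.fn ((ε : ℝ)⁻¹ * x) :=
    φ.smooth.comp (contDiff_const.mul contDiff_id)
  have h2 : (dilate ε φ).fn = ((1 / (ε : ℝ) : ℝ) : ℂ) • fun x : ℝ => φ.fn ((ε : ℝ)⁻¹ * x) := by
    ext x
    simp [dilate, DL1.fn, div_eq_inv_mul]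
  rw [h2, iteratedDeriv_smul' _ h1,
    iteratedDeriv_comp_const_smul (φ.smooth.of_le (by exact_mod_cast le_top))]
  have h3 : eLpNorm (((1 / (ε : ℝ) : ℝ) : ℂ) • fun x : ℝ =>
      (ε : ℝ)⁻¹ ^ j • iteratedDeriv j φ.fn ((ε : ℝ)⁻¹ * x)) 1 volume =
      ENNReal.ofReal (((ε : ℝ) ^ j)⁻¹) * eLpNorm (iteratedDeriv j φ.fn) 1 volume := by
    have hc := continuous_iteratedDeriv' φ.smooth j
    have h4 : eLpNorm (fun x : ℝ => iteratedDeriv j φ.fn ((ε : ℝ)⁻¹ * x)) 1 volume =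
        ENNReal.ofReal (ε : ℝ) * eLpNorm (iteratedDeriv j φ.fn) 1 volume := by
      have h5 := eLpNorm_map_measure (p := 1) (μ := (volume : Measure ℝ))
        (f := fun x : ℝ => (ε : ℝ)⁻¹ * x) hc.aestronglyMeasurable (by fun_prop)
      rw [Real.map_volume_mul_left (inv_ne_zero hε.ne'), eLpNorm_one_smul_measure, inv_inv,
        abs_of_pos hε] at h5
      exact h5.symm
    have h6 : (fun x : ℝ => (ε : ℝ)⁻¹ ^ j • iteratedDeriv j φ.fn ((ε : ℝ)⁻¹ * x)) =
      ((ε : ℝ)⁻¹ ^ j) • fun x : ℝ => iteratedDeriv j φ.fn ((ε : ℝ)⁻¹ * x) := rfl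
    rw [eLpNorm_const_smul, h6, eLpNorm_const_smul, h4, ← ofReal_norm, ← ofReal_norm,
      ← mul_assoc, ← mul_assoc, ← ENNReal.ofReal_mul (by positivity),
      ← ENNReal.ofReal_mul (by positivity), Complex.norm_real, Real.norm_of_nonneg (by positivity),
      Real.norm_of_nonneg (by positivity)]
    rw [inv_pow]
    congr 2
    field_simp
  rw [h3, ENNReal.toReal_mul, ENNReal.toReal_ofReal (by positivity)]
  exact mul_le_mul_of_nonneg_right (inv_pow_le ε (Finset.mem_range_succ_iff.1 hj))
    ENNReal.toReal_nonneg

/-- A test function as an element of `D_{L^1}`. -/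
def ofTest (φ : 𝓓((⊤ : TopologicalSpace.Opens ℝ), ℂ)) : DL1 := ⟨φ, by
  have h : ContDiff ℝ ∞ φ := φ.contDiff
  refine ⟨h, fun j => ?_⟩
  refine (continuous_iteratedDeriv' h j).memLp_of_hasCompactSupport ?_
  induction j with
  | zero => exact φ.hasCompactSupport
  | succ j ih => rw [iteratedDeriv_succ]; exact ih.deriv⟩

/-- A Schwartz function as an element of `D_{L^1}`. -/
def ofSchwartz (ρ : 𝓢(ℝ, ℂ)) : DL1 := ⟨ρ, by
  refine ⟨ρ.smooth ⊤, fun j => ?_⟩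
  have h : iteratedDeriv j ρ = ((SchwartzMap.derivCLM ℂ ℂ)^[j] ρ : 𝓢(ℝ, ℂ)) := by
    induction j with
    | zero => rfl
    | succ j ih => 
      rw [iteratedDeriv_succ, ih, Function.iterate_succ_apply']
      rfl
  rw [h]
  exact ((SchwartzMap.derivCLM ℂ ℂ)^[j] ρ).memLp 1 volume⟩

/-! ### Convolution of a bounded distribution with a function in `D_{L^1}` -/

/-- The convolution `(T ∗ φ)(x) = ⟨T, φ (x - ·)⟩`. -/
def conv (T : BDist) (φ : DL1) : ℝ → ℂ := fun x => T (reflTranslate x φ)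

lemma conv_add_left (S T : BDist) (φ : DL1) : conv (S + T) φ = conv S φ + conv T φ := rfl

lemma conv_smul_left (c : ℂ) (T : BDist) (φ : DL1) : conv (c • T) φ = c • conv T φ := rfl

lemma conv_sub_right (T : BDist) (φ ψ : DL1) : conv T (φ - ψ) = conv T φ - conv T ψ := by
  ext x
  exact map_sub T (reflTranslate x φ) (reflTranslate x ψ)

/-- The space `B'_ap` of almost periodic distributions: bounded distributions `T` for which
`T ∗ φ` is an almost periodic function for every test function `φ`. -/
def Bap' : Submodule ℂ BDist where
  carrier := {T | ∀ φ : 𝓓((⊤ : TopologicalSpace.Opens ℝ), ℂ), IsAP (conv T (ofTest φ))}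
  add_mem' hS hT := fun φ => (hS φ).add (hT φ)
  zero_mem' := fun _ => isAP_const 0
  smul_mem' c _ hT := fun φ => (hT φ).smul c

/-! ### Regularity of the convolution -/

/-- Second order Taylor remainder, in `L^1`. -/
lemma eLpNorm_taylor_le {g g' g'' : ℝ → ℂ} (hg : ∀ x, HasDerivAt g (g' x) x)
    (hg' : ∀ x, HasDerivAt g' (g'' x) x) (hc : Continuous g'') (h : ℝ) :
    eLpNorm (fun z => g (z + h) - g z - h • g' z) 1 volume ≤
      ENNReal.ofReal (2 * h ^ 2) * eLpNorm g'' 1 volume := by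
  have hpt : ∀ z, ‖g (z + h) - g z - h • g' z‖ₑ ≤
      ENNReal.ofReal |h| * ∫⁻ s in Icc (-|h|) |h|, ‖g'' (z + s)‖ₑ := fun z => by
    have hcz : Continuous fun s => g'' (z + s) := by fun_prop
    have hint : IntegrableOn (fun s => g'' (z + s)) (Icc (-|h|) |h|) :=
      hcz.continuousOn.integrableOn_compact isCompact_Icc
    set M : ℝ := ∫ s in Icc (-|h|) |h|, ‖g'' (z + s)‖ with hM
    have h1 : ∀ t ∈ uIcc 0 h, ‖g' (z + t) - g' z‖ ≤ M := fun t ht => by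
      have h2 : ∫ s in (0 : ℝ)..t, g'' (z + s) = g' (z + t) - g' (z + 0) :=
        intervalIntegral.integral_eq_sub_of_hasDerivAt
          (fun s _ => (hg' (z + s)).comp_const_add z s) (hcz.intervalIntegrable _ _)
      rw [add_zero] at h2
      rw [← h2]
      refine intervalIntegral.norm_integral_le_integral_norm_uIoc.trans ?_
      refine setIntegral_mono_set hint.norm (.of_forall fun _ => norm_nonneg _) ?_
      refine (uIoc_subset_uIcc.trans ?_).eventuallyLE
      have h3 : |t| ≤ |h| := by simpa using abs_sub_left_of_mem_uIcc ht
      refine uIcc_subset_Icc ⟨by simp, by simp⟩ (abs_le.1 h3)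
    have h4 : ‖(g (z + h) - h • g' z) - (g (z + 0) - (0 : ℝ) • g' z)‖ ≤ M * ‖h - 0‖ :=
      (convex_uIcc 0 h).norm_image_sub_le_of_norm_hasDerivWithin_le
        (f := fun t => g (z + t) - t • g' z) (f' := fun t => g' (z + t) - (1 : ℝ) • g' z)
        (fun t _ => (((hg (z + t)).comp_const_add z t).sub
          ((hasDerivAt_id t).smul_const (g' z))).hasDerivWithinAt)
        (fun t ht => by simpa using h1 t ht) left_mem_uIcc right_mem_uIcc
    have h5 : ‖g (z + h) - g z - h • g' z‖ ≤ |h| * M := by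
      have : g (z + h) - g z - h • g' z =
        (g (z + h) - h • g' z) - (g (z + 0) - (0 : ℝ) • g' z) := by simp; ring
      rw [this, mul_comm]
      simpa [dlNorm] using h4
    rw [← ofReal_integral_norm_eq_lintegral_enorm hint, ← ENNReal.ofReal_mul (abs_nonneg h),
      ← ofReal_norm]
    exact ENNReal.ofReal_le_ofReal h5
  rw [eLpNorm_one_eq_lintegral_enorm, eLpNorm_one_eq_lintegral_enorm]
  calc ∫⁻ z, ‖g (z + h) - g z - h • g' z‖ₑ
      ≤ ∫⁻ z, ENNReal.ofReal |h| * ∫⁻ s in Icc (-|h|) |h|, ‖g'' (z + s)‖ₑ := lintegral_mono hpt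
    _ = ENNReal.ofReal |h| * ∫⁻ z, ∫⁻ s in Icc (-|h|) |h|, ‖g'' (z + s)‖ₑ :=
        lintegral_const_mul' _ _ ENNReal.ofReal_ne_top
    _ = ENNReal.ofReal |h| * ∫⁻ s in Icc (-|h|) |h|, ∫⁻ z, ‖g'' (z + s)‖ₑ := by
        rw [lintegral_lintegral_swap]
        exact (hc.comp continuous_add).enorm.measurable.aemeasurable
    _ = ENNReal.ofReal |h| * (ENNReal.ofReal (2 * |h|) * ∫⁻ z, ‖g'' z‖ₑ) := by
        simp only [lintegral_add_right_eq_self (fun z => ‖g'' z‖ₑ)]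
        rw [setLIntegral_const, Real.volume_Icc, mul_comm (∫⁻ z, ‖g'' z‖ₑ)]
        congr 3
        ring
    _ = ENNReal.ofReal (2 * h ^ 2) * ∫⁻ z, ‖g'' z‖ₑ := by
        rw [← mul_assoc, ← ENNReal.ofReal_mul (abs_nonneg h)]
        congr 2
        rw [← sq_abs h]
        ring

lemma hasDerivAt_iteratedDeriv {f : ℝ → ℂ} (hf : ContDiff ℝ ∞ f) (j : ℕ) (x : ℝ) :
    HasDerivAt (iteratedDeriv j f) (iteratedDeriv (j + 1) f x) x := by
  rw [iteratedDeriv_succ]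
  exact ((hf.differentiable_iteratedDeriv j (by exact_mod_cast WithTop.coe_lt_top _)) x).hasDerivAt

/-- The function `z ↦ φ (z + h)`. -/
def shift (h : ℝ) (φ : DL1) : DL1 := ⟨fun z => φ.fn (z + h), by
  refine ⟨φ.smooth.comp (contDiff_id.add contDiff_const), fun j => ?_⟩
  rw [iteratedDeriv_comp_add_const]
  exact (φ.mem.2 j).comp_measurePreserving (measurePreserving_add_right volume h)⟩

lemma dlNorm_taylor_le (K : ℕ) (φ : DL1) (h : ℝ) :
    dlNorm 1 K (shift h φ - φ - (h : ℂ) • φ.deriv).fn ≤ 2 * h ^ 2 * dlNorm 1 (K + 2) φ.fn := by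
  have h1 : ∀ j, iteratedDeriv j (shift h φ - φ - (h : ℂ) • φ.deriv).fn = fun z =>
      iteratedDeriv j φ.fn (z + h) - iteratedDeriv j φ.fn z -
        h • iteratedDeriv (j + 1) φ.fn z := fun j => by
    ext z
    have e1 : (shift h φ - φ - (h : ℂ) • φ.deriv).fn =
      (shift h φ).fn - φ.fn - (h : ℂ) • φ.deriv.fn := rfl
    rw [e1, iteratedDeriv_sub (f := (shift h φ).fn - φ.fn) (g := (h : ℂ) • φ.deriv.fn)
        (contDiffAt_of_smooth ((shift h φ).smooth.sub φ.smooth) j z)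
        (contDiffAt_of_smooth ((h : ℂ) • φ.deriv).smooth j z),
      iteratedDeriv_sub (contDiffAt_of_smooth (shift h φ).smooth j z)
        (contDiffAt_of_smooth φ.smooth j z), iteratedDeriv_smul' _ φ.deriv.smooth,
      DL1.iteratedDeriv_deriv]
    have e2 : iteratedDeriv j (shift h φ).fn = fun z => iteratedDeriv j φ.fn (z + h) :=
      iteratedDeriv_comp_add_const ..
    rw [e2]
    simp
  calc dlNorm 1 K (shift h φ - φ - (h : ℂ) • φ.deriv).fn
      ≤ ∑ j ∈ Finset.range (K + 1), 2 * h ^ 2 *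
          (eLpNorm (iteratedDeriv j (DL1.deriv^[2] φ).fn) 1 volume).toReal := by
        refine Finset.sum_le_sum fun j _ => ?_
        rw [h1, DL1.iteratedDeriv_iterate]
        have := eLpNorm_taylor_le (hasDerivAt_iteratedDeriv φ.smooth j)
          (hasDerivAt_iteratedDeriv φ.smooth (j + 1)) (continuous_iteratedDeriv' φ.smooth (j + 2)) h
        refine (ENNReal.toReal_mono ?_ this).trans_eq ?_
        · exact ENNReal.mul_ne_top ENNReal.ofReal_ne_top (φ.mem.2 (j + 2)).eLpNorm_ne_top
        · rw [ENNReal.toReal_mul, ENNReal.toReal_ofReal (by positivity)]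
    _ = 2 * h ^ 2 * dlNorm 1 K (DL1.deriv^[2] φ).fn := by rw [dlNorm, Finset.mul_sum]
    _ ≤ _ := by
        gcongr
        exact φ.dlNorm_iterate_le K 2

lemma BDist.conv_bound (T : BDist) :
    ∃ (K : ℕ) (C : ℝ), 0 ≤ C ∧ ∀ φ x, ‖conv T φ x‖ ≤ C * dlNorm 1 K φ.fn := by
  obtain ⟨K, C, hC, h⟩ := T.bound
  exact ⟨K, C, hC, fun φ x => (h _).trans_eq (by rw [dlNorm_reflTranslate])⟩

lemma hasDerivAt_conv (T : BDist) (φ : DL1) (x : ℝ) :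
    HasDerivAt (conv T φ) (conv T φ.deriv x) x := by
  obtain ⟨K, C, hC, hT⟩ := T.conv_bound
  rw [hasDerivAt_iff_isLittleO_nhds_zero]
  have h1 : (fun h : ℝ => conv T φ (x + h) - conv T φ x - h • conv T φ.deriv x) =O[𝓝 0]
      fun h : ℝ => h ^ 2 := by
    refine Asymptotics.IsBigO.of_bound (C * (2 * dlNorm 1 (K + 2) φ.fn)) (.of_forall fun h => ?_)
    have e : conv T φ (x + h) - conv T φ x - h • conv T φ.deriv x =
        conv T (shift h φ - φ - (h : ℂ) • φ.deriv) x := by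
      have e1 : reflTranslate (x + h) φ = reflTranslate x (shift h φ) := DL1.ext fun y => by
        change φ.fn (x + h - y) = φ.fn (x - y + h)
        congr 1
        ring
      have e2 : reflTranslate x (shift h φ - φ - (h : ℂ) • φ.deriv) = reflTranslate x (shift h φ)
        - reflTranslate x φ - (h : ℂ) • reflTranslate x φ.deriv := rfl
      simp only [conv]
      rw [e1, e2, map_sub, map_sub, map_smul, smul_eq_mul, Complex.real_smul]
    rw [e]
    refine (hT _ x).trans ?_
    rw [Real.norm_of_nonneg (sq_nonneg h)]
    calc _ ≤ C * (2 * h ^ 2 * dlNorm 1 (K + 2) φ.fn) := by gcongr; exact dlNorm_taylor_le K φ h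
      _ = _ := by ring
  refine h1.trans_isLittleO ?_
  simpa using Asymptotics.isLittleO_pow_pow (𝕜 := ℝ) (m := 1) (n := 2) (by norm_num)

lemma deriv_conv (T : BDist) (φ : DL1) : deriv (conv T φ) = conv T φ.deriv :=
  funext fun x => (hasDerivAt_conv T φ x).deriv

lemma iteratedDeriv_conv (T : BDist) (φ : DL1) (j : ℕ) :
    iteratedDeriv j (conv T φ) = conv T (DL1.deriv^[j] φ) := by
  induction j with
  | zero => rfl
  | succ j ih => rw [iteratedDeriv_succ, ih, deriv_conv, Function.iterate_succ_apply']

lemma contDiff_conv (T : BDist) (φ : DL1) : ContDiff ℝ ∞ (conv T φ) := by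
  refine contDiff_of_differentiable_iteratedDeriv fun j _ => ?_
  rw [iteratedDeriv_conv]
  exact fun x => (hasDerivAt_conv T _ x).differentiableAt

/-! ### Density of the test functions in `D_{L^1}` -/

lemma tendsto_tail {g : ℝ → ℂ} (hg : MemLp g 1 volume) :
    Tendsto (fun n : ℕ => ∫⁻ x, {x : ℝ | (n : ℝ) ≤ |x|}.indicator (fun x => ‖g x‖ₑ) x)
      atTop (𝓝 0) := by
  have h1 := hg.2
  rw [eLpNorm_one_eq_lintegral_enorm] at h1
  have h2 := tendsto_lintegral_of_dominated_convergence' (μ := (volume : Measure ℝ))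
    (F := fun (n : ℕ) x => {x : ℝ | (n : ℝ) ≤ |x|}.indicator (fun x => ‖g x‖ₑ) x)
    (f := fun _ => 0) (fun x => ‖g x‖ₑ)
    (fun n => hg.1.enorm.indicator (measurableSet_le measurable_const (by fun_prop)))
    (fun n => .of_forall fun x => indicator_le_self _ _ _) h1.ne (.of_forall fun x => ?_)
  · simpa using h2
  · refine tendsto_const_nhds.congr' ?_
    filter_upwards [eventually_gt_atTop ⌈|x|⌉₊] with n hn
    rw [indicator_of_notMem]
    simpa using Nat.lt_of_ceil_lt hn

/-- A smooth cutoff function: `1` on `[-1, 1]`, with support in `[-2, 2]`. -/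
def bump : ContDiffBump (0 : ℝ) := ⟨1, 2, by norm_num, by norm_num⟩

/-- The function `x ↦ bump (x / (n + 1))`, complex valued. -/
def cutoff (n : ℕ) (x : ℝ) : ℂ := (bump (((n : ℝ) + 1)⁻¹ * x) : ℝ)

lemma contDiff_cutoff (n : ℕ) : ContDiff ℝ ∞ (cutoff n) :=
  Complex.ofRealCLM.contDiff.comp (bump.contDiff.comp (contDiff_const.mul contDiff_id))

lemma hasCompactSupport_cutoff (n : ℕ) : HasCompactSupport (cutoff n) := by
  have h1 : HasCompactSupport fun x : ℝ => bump (((n : ℝ) + 1)⁻¹ * x) := by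
    have := bump.hasCompactSupport.comp_homeomorph
      (Homeomorph.mulLeft₀ ((n : ℝ) + 1)⁻¹ (by positivity))
    exact this
  exact h1.comp_left (g := fun r : ℝ => (r : ℂ)) Complex.ofReal_zero

/-- The product of `φ` with a cutoff, as a test function. -/
def cut (n : ℕ) (φ : DL1) : 𝓓((⊤ : TopologicalSpace.Opens ℝ), ℂ) where
  toFun := cutoff n * φ.fn
  contDiff' := (contDiff_cutoff n).mul φ.smooth
  hasCompactSupport' := (hasCompactSupport_cutoff n).mul_right
  tsupport_subset' := subset_univ _

lemma cutoff_bounds (i : ℕ) : ∃ B : ℝ, 0 ≤ B ∧ ∀ (n : ℕ) (x : ℝ),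
    ‖iteratedDeriv i (fun x => 1 - cutoff n x) x‖ ≤
      {x : ℝ | (n : ℝ) ≤ |x|}.indicator (fun _ => B) x := by
  have hu : ContDiff ℝ ∞ fun y => ((bump y : ℝ) : ℂ) :=
    Complex.ofRealCLM.contDiff.comp bump.contDiff
  have hu1 : ContDiff ℝ ∞ fun y => 1 - ((bump y : ℝ) : ℂ) := contDiff_const.sub hu
  have hcs : HasCompactSupport (iteratedDeriv i fun y => ((bump y : ℝ) : ℂ)) := by
    induction i with
    | zero => exact bump.hasCompactSupport.comp_left (g := fun r : ℝ => (r : ℂ)) Complex.ofReal_zero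
    | succ i ih => rw [iteratedDeriv_succ]; exact ih.deriv
  obtain ⟨B, hB⟩ := hcs.exists_bound_of_continuous (continuous_iteratedDeriv' hu i)
  have hB0 : 0 ≤ B := (norm_nonneg _).trans (hB 0)
  have hb : ∀ y, ‖iteratedDeriv i (fun y => 1 - ((bump y : ℝ) : ℂ)) y‖ ≤ 1 + B := fun y => by
    have h1 : iteratedDeriv i (fun y => 1 - ((bump y : ℝ) : ℂ)) y =
        iteratedDeriv i (fun _ : ℝ => (1 : ℂ)) y - iteratedDeriv i (fun y => ((bump y : ℝ) : ℂ)) y :=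
      iteratedDeriv_sub (contDiffAt_of_smooth contDiff_const i y) (contDiffAt_of_smooth hu i y)
    rw [h1, iteratedDeriv_const']
    refine (norm_sub_le _ _).trans (add_le_add ?_ (hB y))
    split_ifs <;> simp
  refine ⟨1 + B, by positivity, fun n x => ?_⟩
  have h2 : iteratedDeriv i (fun x => 1 - cutoff n x) = fun x => (((n : ℝ) + 1)⁻¹) ^ i •
      iteratedDeriv i (fun y => 1 - ((bump y : ℝ) : ℂ)) (((n : ℝ) + 1)⁻¹ * x) :=
    iteratedDeriv_comp_const_smul (hu1.of_le (by exact_mod_cast le_top)) _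
  have hn : (0 : ℝ) < (n : ℝ) + 1 := by positivity
  rw [h2, norm_smul]
  by_cases hx : (n : ℝ) ≤ |x|
  · rw [indicator_of_mem (by exact hx)]
    refine (mul_le_of_le_one_left (norm_nonneg _) ?_).trans (hb _)
    rw [norm_pow, Real.norm_of_nonneg (by positivity)]
    exact pow_le_one₀ (by positivity) (inv_le_one_of_one_le₀ (by linarith [n.cast_nonneg (α := ℝ)]))
  · rw [indicator_of_notMem (by exact hx)]
    have h3 : (fun y => 1 - ((bump y : ℝ) : ℂ)) =ᶠ[𝓝 (((n : ℝ) + 1)⁻¹ * x)] fun _ => 0 := by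
      have : (((n : ℝ) + 1)⁻¹ * x) ∈ Metric.ball (0 : ℝ) bump.rIn := by
        rw [mem_ball_zero_iff, norm_mul, Real.norm_of_nonneg (by positivity), Real.norm_eq_abs]
        change _ < (1 : ℝ)
        rw [inv_mul_lt_iff₀ hn]
        linarith
      filter_upwards [Metric.isOpen_ball.mem_nhds this] with y hy
      rw [bump.one_of_mem_closedBall (Metric.ball_subset_closedBall hy)]
      simp
    rw [h3.iteratedDeriv_eq, iteratedDeriv_const']
    simp

lemma tendsto_cut (K : ℕ) (φ : DL1) :
    Tendsto (fun n => dlNorm 1 K (φ - ofTest (cut n φ)).fn) atTop (𝓝 0) := by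
  have key : ∀ j, Tendsto (fun n =>
      eLpNorm (iteratedDeriv j (φ - ofTest (cut n φ)).fn) 1 volume) atTop (𝓝 0) := fun j => by
    choose B hB0 hB using cutoff_bounds
    let tail (i n : ℕ) : ℝ≥0∞ := ∫⁻ x, {x : ℝ | (n : ℝ) ≤ |x|}.indicator
      (fun x => ‖iteratedDeriv (j - i) φ.fn x‖ₑ) x
    have h1 : Tendsto (fun n => ∑ i ∈ Finset.range (j + 1),
        ‖(j.choose i : ℂ)‖ₑ * (ENNReal.ofReal (B i) * tail i n)) atTop (𝓝 0) := by
      have := tendsto_finsetSum (Finset.range (j + 1)) fun i _ =>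
        ENNReal.Tendsto.const_mul (a := ‖(j.choose i : ℂ)‖ₑ) (ENNReal.Tendsto.const_mul
          (a := ENNReal.ofReal (B i)) (tendsto_tail (φ.mem.2 (j - i))) (.inr ENNReal.ofReal_ne_top))
          (.inr enorm_ne_top)
      simpa using this
    refine tendsto_of_tendsto_of_tendsto_of_le_of_le tendsto_const_nhds h1
      (fun _ => zero_le) fun n => ?_
    have hc : ContDiff ℝ ∞ fun x => 1 - cutoff n x := contDiff_const.sub (contDiff_cutoff n)
    have h2 : (φ - ofTest (cut n φ)).fn = (fun x => 1 - cutoff n x) * φ.fn := by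
      ext x
      change φ.fn x - cutoff n x * φ.fn x = (1 - cutoff n x) * φ.fn x
      ring
    change eLpNorm (iteratedDeriv j (φ - ofTest (cut n φ)).fn) 1 volume ≤ _
    rw [h2, iteratedDeriv_mul' hc φ.smooth]
    refine (eLpNorm_sum_le (fun i _ => ?_) le_rfl).trans (Finset.sum_le_sum fun i _ => ?_)
    · exact (((continuous_iteratedDeriv' hc i).mul
        (continuous_iteratedDeriv' φ.smooth (j - i))).const_smul _).aestronglyMeasurable
    · rw [eLpNorm_const_smul, eLpNorm_one_eq_lintegral_enorm]
      refine mul_le_mul_right ?_ _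
      rw [← lintegral_const_mul' _ _ ENNReal.ofReal_ne_top]
      refine lintegral_mono fun x => ?_
      rw [Pi.mul_apply, enorm_mul, ← ofReal_norm (iteratedDeriv i _ x)]
      have h3 := hB i n x
      by_cases hx : x ∈ {x : ℝ | (n : ℝ) ≤ |x|}
      · rw [indicator_of_mem hx] at h3 ⊢
        gcongr
      · rw [indicator_of_notMem hx] at h3 ⊢
        rw [le_antisymm h3 (norm_nonneg _)]
        simp
  have h4 := tendsto_finsetSum (Finset.range (K + 1)) fun j _ =>
    (ENNReal.tendsto_toReal ENNReal.zero_ne_top).comp (key j)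
  simpa [dlNorm] using h4

/-- If `T` is an almost periodic distribution, `T ∗ φ` is almost periodic for all `φ` in
`D_{L^1}`. -/
lemma isAP_conv {T : BDist} (hT : T ∈ Bap') (φ : DL1) : IsAP (conv T φ) := by
  obtain ⟨K, C, hC, hb⟩ := T.conv_bound
  refine isAP_of_approx fun ε hε => ?_
  have h1 := (tendsto_cut K φ).const_mul C
  rw [mul_zero] at h1
  obtain ⟨n, hn⟩ := (h1.eventually (gt_mem_nhds hε)).exists
  refine ⟨_, hT (cut n φ), fun x => ?_⟩
  have := hb (φ - ofTest (cut n φ)) x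
  rw [conv_sub_right] at this
  exact this.trans hn.le

lemma conv_mem_Bap {T : BDist} (hT : T ∈ Bap') (φ : DL1) : conv T φ ∈ Bap := by
  have h : ∀ j : ℕ, IsAP (iteratedDeriv j (conv T φ)) := fun j => by
    rw [iteratedDeriv_conv]
    exact isAP_conv hT _
  exact ⟨mem_DL_top (contDiff_conv T φ) h, h⟩

/-! ### The embedding of the almost periodic distributions -/

/-- The set `Σ` of Schwartz functions with integral `1` all of whose higher moments vanish. -/
def Sig : Set 𝓢(ℝ, ℂ) :=
  {ρ | ∫ x, ρ x = 1 ∧ ∀ k : ℕ, 1 ≤ k → ∫ x : ℝ, (x : ℂ) ^ k * ρ x = 0}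

lemma conv_dilate_mem {T : BDist} (hT : T ∈ Bap') (φ : DL1) :
    (fun ε => conv T (dilate ε φ)) ∈ Map := by
  refine ⟨fun ε => conv_mem_Bap hT _, fun k => ?_⟩
  obtain ⟨K, C, hC, hb⟩ := T.conv_bound
  have h1 : Moderate fun ε => ((ε : ℝ) ^ (K + k))⁻¹ := ⟨K + k, Asymptotics.isBigO_refl _ _⟩
  refine h1.of_le (C := (k + 1) * (C * dlNorm 1 (K + k) φ.fn)) fun ε => ?_
  have hε := ε.2.1
  rw [abs_of_nonneg (dlNorm_nonneg _ _ _), abs_of_nonneg (by positivity), mul_assoc]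
  have h0 := dlNorm_nonneg 1 (K + k) φ.fn
  refine dlNorm_top_le (by positivity) fun j hj x => ?_
  rw [iteratedDeriv_conv, mul_assoc]
  refine (hb _ x).trans ?_
  gcongr
  calc dlNorm 1 K (DL1.deriv^[j] (dilate ε φ)).fn
      ≤ dlNorm 1 (K + j) (dilate ε φ).fn := DL1.dlNorm_iterate_le _ K j
    _ ≤ dlNorm 1 (K + k) (dilate ε φ).fn := dlNorm_mono 1 _ (by omega)
    _ ≤ ((ε : ℝ) ^ (K + k))⁻¹ * dlNorm 1 (K + k) φ.fn := dlNorm_dilate_le _ ε φ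
    _ = _ := mul_comm _ _

/-- The map `i_ap : B'_ap → G_ap`, `T ↦ [(T ∗ ρ_ε)_ε]`. -/
def iap (ρ : 𝓢(ℝ, ℂ)) (T : Bap') : Gap :=
  Ideal.Quotient.mk Nap ⟨fun ε => conv T (dilate ε (ofSchwartz ρ)), conv_dilate_mem T.2 _⟩

/-- `m` is the mean value of the distribution `T`: for every test function `φ` with integral `1`,
`X⁻¹ ∫₀ˣ (T ∗ φ)(h) dh` tends to `m` as `X → +∞`. -/
def IsMeanValue (T : BDist) (m : ℂ) : Prop :=
  ∀ φ : 𝓓((⊤ : TopologicalSpace.Opens ℝ), ℂ), ∫ x, φ x = 1 →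
    Tendsto (avg (conv T (ofTest φ))) atTop (𝓝 m)

/-- Schwartz's mean value `M(T)`: the number `m` such that `IsMeanValue T m` (for almost periodic
`T` there is exactly one, which is part of what has to be proved). -/
def meanValue (T : BDist) : ℂ := Classical.epsilon (IsMeanValue T)

end APGF

end

namespace APGF

/-! For fixed `T`, everything rests on the linear functional `φ ↦ mean (conv T φ)`. Almost
periodicity makes it well defined: `T ∗ φ` is almost periodic for every `φ` in `D_{L^1}`
(`isAP_conv`), so its averages converge. It kills derivatives, because `T ∗ ψ' = (T ∗ ψ)'` and the
average over `[0, X]` of the derivative of a bounded function is a boundary term divided by `X`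
(`tendsto_avg_conv_deriv`).

A test function with integral `0` is the derivative of a test function. Hence on test functions the
functional factors through the integral: it equals `(∫ φ) * mean (T ∗ φ₀)` for any fixed `φ₀` with
integral `1` (`mean_conv_ofTest`). This gives both existence and uniqueness of `M(T)`, with value
`mean (T ∗ φ₀)`.

The functions `ρ_ε` need not have compact support, and a function in `D_{L^1}` with integral `0`
need not have an integrable primitive, so the extension to `D_{L^1}` goes by density instead. The
functional and the integral are both continuous for a norm `|·|_{K,1}`, and the cut-off functions
converge in that norm (`tendsto_cut`); therefore proportionality holds on all of `D_{L^1}`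
(`mean_conv`). Since `∫ ρ_ε = 1`, the mean of `T ∗ ρ_ε` is `M(T)` for each `ε` exactly, with no
negligible error left to absorb. -/

lemma IsMeanValue.eq_of_tendsto {T : BDist} {m : ℂ} (h : IsMeanValue T m)
    {φ : 𝓓((⊤ : TopologicalSpace.Opens ℝ), ℂ)} (hφ : ∫ x, φ x = 1) {l : ℂ}
    (hl : Tendsto (avg (conv T (ofTest φ))) atTop (𝓝 l)) : m = l :=
  tendsto_nhds_unique (h φ hφ) hl

/-! ### Test functions: normalisation and primitives. -/

/-- There is a test function with integral `1`. -/
lemma exists_test_integral_eq_one :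
    ∃ φ : 𝓓((⊤ : TopologicalSpace.Opens ℝ), ℂ), ∫ x, φ x = 1 := by
  refine ⟨⟨fun x => (bump.normed volume x : ℂ),
    Complex.ofRealCLM.contDiff.comp bump.contDiff_normed,
    bump.hasCompactSupport_normed.comp_left (g := fun r : ℝ => (r : ℂ)) Complex.ofReal_zero,
    subset_univ _⟩, ?_⟩
  change ∫ x, (bump.normed volume x : ℂ) = 1
  rw [integral_complex_ofReal, bump.integral_normed, Complex.ofReal_one]

/-- A test function with integral `0` is the derivative of a test function. -/
lemma exists_primitive_of_integral_eq_zero {φ : 𝓓((⊤ : TopologicalSpace.Opens ℝ), ℂ)}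
    (hφ : ∫ x, φ x = 0) :
    ∃ ψ : 𝓓((⊤ : TopologicalSpace.Opens ℝ), ℂ), ofTest φ = (ofTest ψ).deriv := by
  have hs : ContDiff ℝ ∞ φ := φ.contDiff
  obtain ⟨R, hR⟩ := φ.hasCompactSupport.isBounded.subset_closedBall 0
  have hsupp : ∀ x, φ x ≠ 0 → |x| ≤ R := fun x hx => by
    simpa using hR (subset_tsupport _ hx)
  -- The support of `φ` lies in `[-R, R]`. Starting at `-(R + 1)` instead of `-R` puts the support
  -- strictly to the right of the base point, as the half-open interval of integration requires
  -- below.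
  let f : ℝ → ℂ := fun x => ∫ t in (-(R + 1))..x, φ t
  have hd : ∀ x, HasDerivAt f (φ x) x := fun x =>
    intervalIntegral.integral_hasDerivAt_right (hs.continuous.intervalIntegrable _ _)
      hs.continuous.stronglyMeasurable.stronglyMeasurableAtFilter hs.continuous.continuousAt
  have hf' : deriv f = φ := funext fun x => (hd x).deriv
  have hf : ContDiff ℝ ∞ f := by
    rw [contDiff_infty_iff_deriv, hf']
    exact ⟨fun x => (hd x).differentiableAt, hs⟩
  have hc : HasCompactSupport f := by
    refine HasCompactSupport.intro (isCompact_Icc (a := -(R + 1)) (b := R + 1)) fun x hx => ?_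
    rcases lt_or_ge x (-(R + 1)) with h | h
    · have : ∫ t in (-(R + 1))..x, φ t = ∫ t in (-(R + 1))..x, (0 : ℂ) := by
        refine intervalIntegral.integral_congr fun t ht => ?_
        rw [uIcc_of_ge h.le] at ht
        by_contra h0
        linarith [(abs_le.1 (hsupp t h0)).1, ht.2]
      simpa [f] using this
    · have h' : R + 1 < x := not_le.1 fun h' => hx ⟨h, h'⟩
      change ∫ t in (-(R + 1))..x, φ t = 0
      -- Right of the support, the primitive has collected the whole integral of `φ`, which is `0`.
      -- It is here that the vanishing integral gives compact support.
      rw [intervalIntegral.integral_eq_integral_of_support_subset fun t ht => ?_, hφ]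
      have := abs_le.1 (hsupp t ht)
      exact ⟨by linarith, by linarith⟩
  refine ⟨⟨f, hf, hc, subset_univ _⟩, DL1.ext fun x => ?_⟩
  exact (congrFun hf' x).symm

/-! ### Derivatives have mean value zero. -/

/-- The mean value of the derivative of a bounded function is `0`. -/
lemma tendsto_avg_of_hasDerivAt {f f' : ℝ → ℂ} (hf : ∀ x, HasDerivAt f (f' x) x)
    (hc : Continuous f') {C : ℝ} (hb : ∀ x, ‖f x‖ ≤ C) : Tendsto (avg f') atTop (𝓝 0) := by
  have key : ∀ X, avg f' X = X⁻¹ • (f X - f 0) := fun X => by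
    rw [avg, intervalIntegral.integral_eq_sub_of_hasDerivAt (fun x _ => hf x)
      (hc.intervalIntegrable _ _)]
  -- The bound `C + C` comes from the two boundary values `f X` and `f 0`.
  refine squeeze_zero_norm' (a := fun X : ℝ => X⁻¹ * (C + C)) ?_ ?_
  · filter_upwards [eventually_gt_atTop (0 : ℝ)] with X hX
    rw [key, norm_smul, norm_inv, Real.norm_of_nonneg hX.le]
    gcongr
    exact (norm_sub_le _ _).trans (add_le_add (hb X) (hb 0))
  · simpa using tendsto_inv_atTop_zero.mul_const (C + C)

/-- Continuity of `T` bounds `T ∗ φ` uniformly by a multiple of some `|φ|_{K,1}`, and `T ∗ φ'` is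
its derivative. The argument works for every bounded distribution, almost periodic or not. -/
lemma tendsto_avg_conv_deriv (T : BDist) (φ : DL1) :
    Tendsto (avg (conv T φ.deriv)) atTop (𝓝 0) := by
  obtain ⟨K, C, -, hb⟩ := T.conv_bound
  exact tendsto_avg_of_hasDerivAt (hasDerivAt_conv T φ) (contDiff_conv T _).continuous (hb φ)

/-! ### The functional `φ ↦ mean (T ∗ φ)` and its proportionality to the integral. -/

lemma avg_smul (c : ℂ) (f : ℝ → ℂ) (X : ℝ) : avg (c • f) X = c * avg f X := by
  simp only [avg, Pi.smul_apply, smul_eq_mul, intervalIntegral.integral_const_mul, mul_smul_comm]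

lemma conv_smul_right (c : ℂ) (T : BDist) (φ : DL1) : conv T (c • φ) = c • conv T φ := by
  ext x
  exact map_smul T c (reflTranslate x φ)

lemma DL1.integrable (φ : DL1) : Integrable φ.fn := memLp_one_iff_integrable.1 (φ.mem.2 0)

/-- The term `j = 0` of the norm is already the `L^1` norm. The index `K` is left free so that the
density argument can use for the integral the same norm that controls `T`. -/
lemma DL1.norm_integral_le (φ : DL1) (K : ℕ) : ‖∫ x, φ.fn x‖ ≤ dlNorm 1 K φ.fn := by
  refine le_trans ?_ (dlNorm_mono 1 φ.fn K.zero_le)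
  simp only [dlNorm, zero_add, Finset.range_one, Finset.sum_singleton, iteratedDeriv_zero]
  rw [eLpNorm_one_eq_lintegral_enorm, ← integral_norm_eq_lintegral_enorm φ.integrable.1]
  exact norm_integral_le_integral_norm _

lemma mean_conv_sub {T : BDist} (hT : T ∈ Bap') (φ ψ : DL1) :
    mean (conv T (φ - ψ)) = mean (conv T φ) - mean (conv T ψ) := by
  rw [conv_sub_right, (isAP_conv hT φ).mean_sub (isAP_conv hT ψ)]

/-- Since `mean` is a `limUnder`, homogeneity is obtained by comparing two limits of the same
averages; both exist by almost periodicity. -/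
lemma mean_conv_smul {T : BDist} (hT : T ∈ Bap') (c : ℂ) (φ : DL1) :
    mean (conv T (c • φ)) = c * mean (conv T φ) := by
  refine tendsto_nhds_unique (isAP_conv hT _).tendsto_avg ?_
  rw [conv_smul_right]
  exact ((isAP_conv hT φ).tendsto_avg.const_mul c).congr fun X => (avg_smul c _ X).symm

/-- On test functions, the mean value of `T ∗ φ` is proportional to the integral of `φ`. -/
lemma mean_conv_ofTest {T : BDist} (hT : T ∈ Bap') {φ₀ : 𝓓((⊤ : TopologicalSpace.Opens ℝ), ℂ)}
    (h₀ : ∫ x, φ₀ x = 1) (φ : 𝓓((⊤ : TopologicalSpace.Opens ℝ), ℂ)) :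
    mean (conv T (ofTest φ)) = (∫ x, φ x) * mean (conv T (ofTest φ₀)) := by
  set c := ∫ x, φ x with hc
  -- Subtracting the multiple of `φ₀` that has the same integral reduces the claim to a test
  -- function with integral `0`, where the functional must vanish.
  have h1 : ∫ x, (φ - c • φ₀) x = 0 := by
    have h := integral_sub (ofTest φ).integrable (c • ofTest φ₀).integrable
    refine h.trans ?_
    change c - ∫ x, c • φ₀ x = 0
    rw [integral_smul, h₀, smul_eq_mul, mul_one, sub_self]
  obtain ⟨ψ, hψ⟩ := exists_primitive_of_integral_eq_zero h1
  have h2 : ofTest (φ - c • φ₀) = ofTest φ - c • ofTest φ₀ := rfl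
  -- The averages of `T ∗ ψ'` tend to their mean and also to `0`; as `ψ' = φ - c • φ₀`, linearity
  -- turns this into the claim.
  have h3 := tendsto_nhds_unique (isAP_conv hT _).tendsto_avg (tendsto_avg_conv_deriv T (ofTest ψ))
  rw [← hψ, h2, mean_conv_sub hT, mean_conv_smul hT] at h3
  exact sub_eq_zero.1 h3

/-- For all `φ` in `D_{L^1}`, the mean value of `T ∗ φ` is proportional to the integral of `φ`. -/
lemma mean_conv {T : BDist} (hT : T ∈ Bap') {φ₀ : 𝓓((⊤ : TopologicalSpace.Opens ℝ), ℂ)}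
    (h₀ : ∫ x, φ₀ x = 1) (φ : DL1) :
    mean (conv T φ) = (∫ x, φ.fn x) * mean (conv T (ofTest φ₀)) := by
  obtain ⟨K, C, -, hb⟩ := T.conv_bound
  have hcut := tendsto_cut K φ
  -- A mean is bounded by the supremum norm, so the difference of the means is at most `C` times the
  -- norm `|·|_{K,1}` of `φ - cut n φ`.
  have h1 : Tendsto (fun n => mean (conv T (ofTest (cut n φ)))) atTop (𝓝 (mean (conv T φ))) := by
    rw [tendsto_iff_norm_sub_tendsto_zero]
    refine squeeze_zero (fun _ => norm_nonneg _) (fun n => ?_) (by simpa using hcut.const_mul C)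
    rw [norm_sub_rev, ← mean_conv_sub hT]
    exact (isAP_conv hT _).norm_mean_le (hb _)
  have h2 : Tendsto (fun n => ∫ x, (ofTest (cut n φ)).fn x) atTop (𝓝 (∫ x, φ.fn x)) := by
    rw [tendsto_iff_norm_sub_tendsto_zero]
    refine squeeze_zero (fun _ => norm_nonneg _) (fun n => ?_) hcut
    rw [norm_sub_rev, ← integral_sub φ.integrable (ofTest (cut n φ)).integrable]
    exact (φ - ofTest (cut n φ)).norm_integral_le K
  -- The identity is known for each `cut n φ`, and both of its sides converge.
  exact tendsto_nhds_unique h1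
    ((h2.mul_const _).congr fun n => (mean_conv_ofTest hT h₀ (cut n φ)).symm)

/-! ### Schwartz's mean value and the regularisations `T ∗ ρ_ε`. -/

lemma integral_dilate (ε : I) (φ : DL1) : ∫ x, (dilate ε φ).fn x = ∫ x, φ.fn x := by
  have hε := ε.2.1
  change ∫ x : ℝ, ((1 / (ε : ℝ) : ℝ) : ℂ) * φ.fn (x / ε) = _
  rw [integral_const_mul, Measure.integral_comp_div φ.fn (ε : ℝ), abs_of_pos hε,
    Complex.real_smul, ← mul_assoc, ← Complex.ofReal_mul, one_div_mul_cancel hε.ne',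
    Complex.ofReal_one, one_mul]

lemma isMeanValue_mean_conv {T : BDist} (hT : T ∈ Bap')
    {φ₀ : 𝓓((⊤ : TopologicalSpace.Opens ℝ), ℂ)} (h₀ : ∫ x, φ₀ x = 1) :
    IsMeanValue T (mean (conv T (ofTest φ₀))) := fun φ hφ => by
  have := (isAP_conv hT (ofTest φ)).tendsto_avg
  rwa [mean_conv_ofTest hT h₀, hφ, one_mul] at this

/-- `meanValue` is a Hilbert choice, so it says nothing until some mean value is exhibited; `mean (T
∗ φ₀)` is one. Uniqueness needs an actual normalised test function `φ₀`: without one, `IsMeanValue T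
m` would hold vacuously for every `m`. -/
lemma isMeanValue_iff {T : BDist} (hT : T ∈ Bap') (m : ℂ) :
    IsMeanValue T m ↔ m = meanValue T := by
  obtain ⟨φ₀, h₀⟩ := exists_test_integral_eq_one
  have h : IsMeanValue T (meanValue T) :=
    Classical.epsilon_spec ⟨_, isMeanValue_mean_conv hT h₀⟩
  exact ⟨fun hm => hm.eq_of_tendsto h₀ (h φ₀ h₀), fun hm => hm ▸ h⟩

/-- The mean value of `T ∗ φ` is `M(T)` for every `φ` in `D_{L^1}` with integral `1`. -/
lemma mean_conv_eq_meanValue {T : BDist} (hT : T ∈ Bap') {φ : DL1} (hφ : ∫ x, φ.fn x = 1) :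
    mean (conv T φ) = meanValue T := by
  obtain ⟨φ₀, h₀⟩ := exists_test_integral_eq_one
  rw [mean_conv hT h₀, hφ, one_mul]
  -- The auxiliary `φ₀` drops out here: whichever one was chosen, `mean (T ∗ φ₀)` is a mean value of
  -- `T`, hence the mean value.
  exact (isMeanValue_iff hT _).1 (isMeanValue_mean_conv hT h₀)

end APGF

theorem mainTheorem7 (ρ : 𝓢(ℝ, ℂ)) (hρ : ρ ∈ APGF.Sig) (T : APGF.Bap') :
    (∀ m : ℂ, APGF.IsMeanValue T m ↔ m = APGF.meanValue T) ∧
    (∀ ε : APGF.I, Tendsto (APGF.avg (APGF.conv T (APGF.dilate ε (APGF.ofSchwartz ρ)))) atTop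
      (𝓝 (APGF.meanValue T))) ∧
    APGF.Mg (APGF.iap ρ T) = algebraMap ℂ APGF.GenC (APGF.meanValue T) := by
  have h : ∀ ε, APGF.mean (APGF.conv T (APGF.dilate ε (APGF.ofSchwartz ρ))) =
      APGF.meanValue T := fun ε =>
    APGF.mean_conv_eq_meanValue T.2 ((APGF.integral_dilate ε _).trans hρ.1)
  refine ⟨APGF.isMeanValue_iff T.2, fun ε => ?_, ?_⟩
  · rw [← h ε]
    exact (APGF.isAP_conv T.2 _).tendsto_avg
  · rw [APGF.iap, APGF.Mg_mk]
    -- The two representatives agree as families, for every `ε`, before passing to the quotient;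
    -- `algebraMap` unfolds to the class of the constant family.
    exact congrArg (Ideal.Quotient.mk APGF.NegC) (Subtype.ext (funext h))
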